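/- Let $K$ be an infinite field, let $n\ge 1$, $m,d\ge 0$ be integers and let $A=(k_1,\dots,k_d)\in\mathbb N^d$. For a projective subspace $P\subset\mathbb P^n=\mathbb P^n_K$ and an integer $a$, write $P^a$ for the subscheme defined by the $a$-th power of the ideal sheaf of $P$ (so $P^a=\emptyset$ if $a\le 0$). Write $h_{\mathbb P^n}(Z,m)=\dim H^0(\mathcal O_{\mathbb P^n}(m))-\dim H^0(\mathcal I_Z(m))$ for the Hilbert function of a subscheme $Z$. Let $p_1,\dots,p_d\in\mathbb P^n$ be distinct points and let $Z=p_1^{k_1}\cup\dots\cup p_d^{k_d}$ be the corresponding $A$-subscheme; its degree is $\deg Z=\sum_{j=1}^d\binom{n+k_j-1}{n}$. *Expected linear obstructions.* Let $Y=P_1^{a_1}\cup\dots\cup P_s^{a_s}$ with $P_1,\dots,P_s$ projective subspaces, let $P$ be a projective subspace and $k\ge 1$. The expected linear obstruction scheme on $P^k$ induced by $m$-ics through $P^{k-1}\cup Y$ is $$\Bigl(P^{k-1}\cup\bigcup_{i_1<\dots<i_r}\operatorname{span}(P\cup P_{i_1}\cup\dots\cup P_{i_r})^{\,k+a_{i_1}+\dots+a_{i_r}-rm-1}\Bigr)\cap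 P^k .$$ The scheme $P^k\cup Y$ is only linearly obstructed by $P^{k-1}\cup Y$ in degree $m$ if the base locus (as a scheme) of the linear system of $m$-ics through $P^{k-1}\cup Y$ meets $P^k$ in precisely this scheme. The scheme $P^k\cup Y$ is only linearly obstructed by $Y$ in degree $m$ if, for each $1\le\ell\le k$, $P^\ell\cup Y$ is only linearly obstructed by $P^{\ell-1}\cup Y$. The scheme $Z$, built up in the order $p_1,\dots,p_d$, has only the expected linear obstructions in degree $m$ if, for each $1\le j\le d$, $p_1^{k_1}\cup\dots\cup p_j^{k_j}$ is only linearly obstructed in degree $m$ by $p_1^{k_1}\cup\dots\cup p_{j-1}^{k_{j-1}}$. **Theorem.** There are hyperplanes of $\mathbb P^n$ that contain none of $p_1,\dots,p_d$. Let $H\cong\mathbb P^{n-1}$ be any of them. For $1\le r<s\le d$ the line through $p_s$ and $p_r$ meets $H$ in exactly one point. For $1\le j\le d-1$ and $0\le i\le k_{j+1}-1$ put $$W_{ji}=\bigcup_{r=1}^{j}\bigl(\operatorname{span}(p_{j+1},p_r)\cap H\bigr)^{k_r+i-m}\subset H\cong\mathbb P^{n-1},$$ a $C_{ji}$-subscheme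 of $\mathbb P^{n-1}$ with $C_{ji}=(k_1+i-m,\dots,k_j+i-m)$ (points of its support coincide when $p_{j+1}$ is collinear with two of $p_1,\dots,p_j$). Then $$h_{\mathbb P^n}(Z,m)\le\deg Z-\sum_{j=1}^{d-1}\ \sum_{i=0}^{k_{j+1}-1}h_{\mathbb P^{n-1}}(W_{ji},i),$$ and equality holds if and only if $Z$, built up in the order $p_1,\dots,p_d$, has only the expected linear obstructions in degree $m$. -/

import Mathlib

open scoped LinearAlgebra.Projectivization

/-!
Closed subschemes of the projective space of lines in `K ^ N` are given by homogeneous ideals of the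
coordinate ring `K[x_0, ..., x_(N-1)]`; two ideals give the same subscheme iff they have the same
saturation.  Union of subschemes is intersection of ideals, intersection of subschemes is sum.
-/

namespace FatPoints

/-- The irrelevant ideal `(x_0, ..., x_(N-1))`. -/
noncomputable def irrelevantIdeal (K : Type*) [Field K] (N : ℕ) : Ideal (MvPolynomial (Fin N) K) :=
  Ideal.span (Set.range MvPolynomial.X)

/-- The saturation of an ideal with respect to the irrelevant ideal. -/
noncomputable def saturation {K : Type*} [Field K] {N : ℕ} (I : Ideal (MvPolynomial (Fin N) K)) :
    Ideal (MvPolynomial (Fin N) K) where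
  carrier := {f | ∃ t : ℕ, ∀ g ∈ irrelevantIdeal K N ^ t, g * f ∈ I}
  zero_mem' := ⟨0, fun g _ => by simp⟩
  add_mem' := by
    rintro a b ⟨s, hs⟩ ⟨t, ht⟩
    refine ⟨s + t, fun g hg => ?_⟩
    rw [mul_add]
    exact I.add_mem (hs g (Ideal.pow_le_pow_right (Nat.le_add_right s t) hg))
      (ht g (Ideal.pow_le_pow_right (Nat.le_add_left t s) hg))
  smul_mem' := by
    rintro c f ⟨t, ht⟩
    refine ⟨t, fun g hg => ?_⟩
    have h : g * (c • f) = c * (g * f) := by rw [smul_eq_mul]; ring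
    rw [h]
    exact I.mul_mem_left c (ht g hg)

/-- Two ideals define the same closed subscheme of projective space. -/
def SameSubscheme {K : Type*} [Field K] {N : ℕ} (I J : Ideal (MvPolynomial (Fin N) K)) : Prop :=
  saturation I = saturation J

/-- The linear system of `m`-ics through the subscheme `Z` given by `I`, that is
`H⁰(I_Z(m))`: the degree `m` part of the saturation of `I`. -/
noncomputable def linearSystem {K : Type*} [Field K] {N : ℕ} (I : Ideal (MvPolynomial (Fin N) K)) (m : ℕ) :
    Submodule K (MvPolynomial (Fin N) K) :=
  MvPolynomial.homogeneousSubmodule (Fin N) K m ⊓ (saturation I).restrictScalars K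

/-- The ideal of the base locus (as a scheme) of the linear system of `m`-ics through the
subscheme given by `I`. -/
noncomputable def baseLocus {K : Type*} [Field K] {N : ℕ} (I : Ideal (MvPolynomial (Fin N) K)) (m : ℕ) :
    Ideal (MvPolynomial (Fin N) K) :=
  Ideal.span (linearSystem I m : Set (MvPolynomial (Fin N) K))

/-- The Hilbert function `h(Z, m) = dim H⁰(O(m)) - dim H⁰(I_Z(m))`. -/
noncomputable def hilbertFunction {K : Type*} [Field K] {N : ℕ}
    (I : Ideal (MvPolynomial (Fin N) K)) (m : ℕ) : ℕ :=
  Module.finrank K (MvPolynomial.homogeneousSubmodule (Fin N) K m) -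
    Module.finrank K (linearSystem I m)

/-- The subscheme given by `I` is of dimension at most zero and has degree `D`: its Hilbert
polynomial is the constant `D`. -/
def HasDegree {K : Type*} [Field K] {N : ℕ} (I : Ideal (MvPolynomial (Fin N) K)) (D : ℕ) : Prop :=
  ∀ᶠ t in Filter.atTop, hilbertFunction I t = D

/-- The homogeneous ideal of the projective subspace attached to a vector subspace `L`: it is
generated by the linear forms vanishing on `L`.  The ideal of the multiple subspace `L^a` is its
`a`-th power (so `L^0` is empty). -/
noncomputable def linearIdeal {K : Type*} [Field K] {N : ℕ} (L : Submodule K (Fin N → K)) :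
    Ideal (MvPolynomial (Fin N) K) :=
  Ideal.span {f | f ∈ MvPolynomial.homogeneousSubmodule (Fin N) K 1 ∧
    ∀ v ∈ L, MvPolynomial.eval v f = 0}

/-- The ideal of the union of the multiple projective subspaces `P_r^(k_r)`. -/
noncomputable def unionIdeal {K : Type*} [Field K] {N : ℕ} {ι : Type*} (P : ι → Submodule K (Fin N → K))
    (k : ι → ℕ) : Ideal (MvPolynomial (Fin N) K) :=
  ⨅ r, linearIdeal (P r) ^ k r

/-- The ideal of the union of the multiple points `p_r^(k_r)`. -/
noncomputable def fatPointIdeal {K : Type*} [Field K] {N : ℕ} {ι : Type*} (p : ι → ℙ K (Fin N → K))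
    (k : ι → ℕ) : Ideal (MvPolynomial (Fin N) K) :=
  unionIdeal (fun r => (p r).submodule) k

/-- The expected linear obstruction scheme on `Q^a` (where `1 ≤ a`) induced by the `m`-ics through
`Q^(a-1)` and the union `Z` of the `P_r^(k_r)`: the intersection of `Q^a` with the union of
`Q^(a-1)` and all the `span(Q, P_r (r ∈ S))^j` with `j = a + ∑_{r ∈ S} k_r - |S| m - 1` (read as `0`
if negative), for sets `S` of indices. -/
noncomputable def expectedObstruction {K : Type*} [Field K] {N : ℕ} {ι : Type*} (m : ℕ)
    (Q : Submodule K (Fin N → K)) (a : ℕ) (P : ι → Submodule K (Fin N → K)) (k : ι → ℕ) :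
    Ideal (MvPolynomial (Fin N) K) :=
  (linearIdeal Q ^ (a - 1) ⊓
    ⨅ S : Finset ι, linearIdeal (Q ⊔ S.sup P) ^ ((a + ∑ r ∈ S, k r) - (S.card * m + 1))) ⊔
  linearIdeal Q ^ a

/-- With `Z` the union of the `P_r^(k_r)`: in degree `m`, the scheme `Q^a ∪ Z` is only linearly
obstructed by `Q^(a-1) ∪ Z`, i.e. the base locus of the linear system of `m`-ics through
`Q^(a-1) ∪ Z` meets `Q^a` in precisely the expected linear obstruction scheme. -/
def OnlyLinearlyObstructedStep {K : Type*} [Field K] {N : ℕ} {ι : Type*} (m : ℕ)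
    (Q : Submodule K (Fin N → K)) (a : ℕ) (P : ι → Submodule K (Fin N → K)) (k : ι → ℕ) : Prop :=
  SameSubscheme (baseLocus (linearIdeal Q ^ (a - 1) ⊓ unionIdeal P k) m ⊔ linearIdeal Q ^ a)
    (expectedObstruction m Q a P k)

/-- With `Z` the union of the `P_r^(k_r)`: in degree `m`, the scheme `Q^a ∪ Z` is only linearly
obstructed by `Z`. -/
def OnlyLinearlyObstructed {K : Type*} [Field K] {N : ℕ} {ι : Type*} (m : ℕ)
    (Q : Submodule K (Fin N → K)) (a : ℕ) (P : ι → Submodule K (Fin N → K)) (k : ι → ℕ) : Prop :=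
  ∀ b : ℕ, 1 ≤ b → b ≤ a → OnlyLinearlyObstructedStep m Q b P k

/-- The union of `P_1^(k_1), ..., P_d^(k_d)`, built up in the given order, has only the expected
linear obstructions in degree `m`: for each `j`, the scheme `P_1^(k_1) ∪ ... ∪ P_j^(k_j)` is only
linearly obstructed by `P_1^(k_1) ∪ ... ∪ P_(j-1)^(k_(j-1))`. -/
def OnlyExpectedLinearObstructions {K : Type*} [Field K] {N d : ℕ} (m : ℕ)
    (P : Fin d → Submodule K (Fin N → K)) (k : Fin d → ℕ) : Prop :=
  ∀ j : Fin d, OnlyLinearlyObstructed m (P j) (k j)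
    (fun r : {r : Fin d // r < j} => P r) (fun r : {r : Fin d // r < j} => k r)

/-- `ψ` parametrizes a hyperplane (the image of `ψ`) of projective `n`-space, identified in this way
with projective `(n-1)`-space, that contains none of the points `p_r`. -/
def IsAvoidingHyperplane {K : Type*} [Field K] {n d : ℕ} (p : Fin d → ℙ K (Fin (n + 1) → K))
    (ψ : (Fin n → K) →ₗ[K] (Fin (n + 1) → K)) : Prop :=
  Function.Injective ψ ∧ ∀ r, ¬ (p r).submodule ≤ LinearMap.range ψ

/-- The point `q j r` of projective `(n-1)`-space, for `r < j`, is the intersection of the line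
through `p_j` and `p_r` with the hyperplane parametrized by `ψ`. -/
def AreTraces {K : Type*} [Field K] {n d : ℕ} (p : Fin d → ℙ K (Fin (n + 1) → K))
    (ψ : (Fin n → K) →ₗ[K] (Fin (n + 1) → K)) (q : Fin d → Fin d → ℙ K (Fin n → K)) : Prop :=
  ∀ j r, r < j → (q j r).submodule = ((p j).submodule ⊔ (p r).submodule).comap ψ

/-- The ideal of the induced subscheme of projective `(n-1)`-space attached to the point with index
`j` and to `i`: the union over `r < j` of the multiple points `(q j r)^(k_r + i - m)`, where a
nonpositive exponent means the empty scheme. -/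
noncomputable def inducedIdeal {K : Type*} [Field K] {n d : ℕ} (m : ℕ) (k : Fin d → ℕ)
    (q : Fin d → Fin d → ℙ K (Fin n → K)) (j : Fin d) (i : ℕ) : Ideal (MvPolynomial (Fin n) K) :=
  fatPointIdeal (fun r : {r : Fin d // r < j} => q j r)
    (fun r : {r : Fin d // r < j} => k r + i - m)

end FatPoints

/-! Impose the points one at a time, and the multiplicity of each point one unit at a time. An
`m`-ic vanishing to order `i` at `v` has a leading form of degree `i` there, a form on the
hyperplane `H` complementary to `v`, and it vanishes to order `i + 1` exactly when this form is
zero. By rank-nullity each step lowers the dimension of the linear system by that of `leadingForms`;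
telescoping writes `h(Z, m)` as the sum of these dimensions (`hilbertFunction_fatPointIdeal`).

An `m`-ic with orders `i` at `v` and `k_r` at `p_r` has order at least `k_r + i - m` along the line
joining them (`mem_linearIdeal_sup_finset`), so its leading form lies in the system of `i`-ics
through the induced scheme (`leadingForms_le`). The forms of degree `i < k` on `H` together count
the degree of a `k`-fold point, so degree minus induced Hilbert functions is the sum of the
dimensions of the induced systems. This gives the inequality, with equality iff every inclusion is
an equality.

`onlyLinearlyObstructedStep_iff` identifies each such equality with the obstruction condition:
modulo order `i + 1` at `v` and up to saturation, the base locus is cut out by the cones over the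
leading forms, the expected scheme by the cones over the induced system. Spans with several points
impose nothing beyond the lines, by the join estimate applied inside `H`. All orders of vanishing
are read off the coefficients of `f (T v + ψ y)` as a polynomial in `T`. -/

namespace FatPoints

/-! ### Linear forms, ideals of subspaces and pullback -/

section LinearForms

variable {K : Type*} [Field K] {M N : ℕ}

/-- The linear form attached to a functional. -/
noncomputable def linForm :
    Module.Dual K (Fin N → K) →ₗ[K] MvPolynomial (Fin N) K where
  toFun ℓ := ∑ i, ℓ (Pi.single i 1) • MvPolynomial.X i
  map_add' a b := by simp [add_smul, Finset.sum_add_distrib]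
  map_smul' c a := by simp [mul_smul, Finset.smul_sum]

theorem linForm_apply (ℓ : Module.Dual K (Fin N → K)) :
    linForm ℓ = ∑ i, ℓ (Pi.single i 1) • MvPolynomial.X i := rfl

theorem dual_eq_sum (ℓ : Module.Dual K (Fin N → K)) :
    ℓ = ∑ i, ℓ (Pi.single i 1) • LinearMap.proj (R := K) (φ := fun _ : Fin N => K) i := by
  refine LinearMap.pi_ext' fun j => LinearMap.ext_ring ?_
  simp [Finset.sum_apply, Pi.single_apply]

theorem linForm_proj (i : Fin N) :
    linForm (LinearMap.proj (R := K) (φ := fun _ : Fin N => K) i) = MvPolynomial.X i := by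
  simp [linForm_apply, Pi.single_apply, ite_smul]

theorem eval_linForm (ℓ : Module.Dual K (Fin N → K)) (v : Fin N → K) :
    MvPolynomial.eval v (linForm ℓ) = ℓ v := by
  conv_rhs => rw [dual_eq_sum ℓ]
  simp [linForm_apply, MvPolynomial.smul_eval]

theorem isHomogeneous_linForm (ℓ : Module.Dual K (Fin N → K)) :
    (linForm ℓ).IsHomogeneous 1 := by
  rw [← MvPolynomial.mem_homogeneousSubmodule, linForm_apply]
  exact Submodule.sum_mem _ fun i _ => Submodule.smul_mem _ _ (MvPolynomial.isHomogeneous_X K i)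

theorem exists_linForm_eq {f : MvPolynomial (Fin N) K} (hf : f.IsHomogeneous 1) :
    ∃ ℓ, linForm ℓ = f := by
  rw [← MvPolynomial.mem_homogeneousSubmodule, MvPolynomial.homogeneousSubmodule_one_eq_span_X] at hf
  have : Submodule.span K (Set.range MvPolynomial.X) ≤ LinearMap.range (linForm (K := K) (N := N)) := by
    rw [Submodule.span_le]
    rintro _ ⟨i, rfl⟩
    exact ⟨_, linForm_proj i⟩
  exact this hf

theorem linForm_mem_linearIdeal {L : Submodule K (Fin N → K)} {ℓ : Module.Dual K (Fin N → K)}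
    (h : ∀ v ∈ L, ℓ v = 0) : linForm ℓ ∈ linearIdeal L :=
  Ideal.subset_span ⟨isHomogeneous_linForm ℓ, fun v hv => by rw [eval_linForm, h v hv]⟩

theorem linearIdeal_le {L : Submodule K (Fin N → K)} {I : Ideal (MvPolynomial (Fin N) K)}
    (h : ∀ ℓ : Module.Dual K (Fin N → K), (∀ v ∈ L, ℓ v = 0) → linForm ℓ ∈ I) :
    linearIdeal L ≤ I := by
  refine Ideal.span_le.2 ?_
  rintro f ⟨hf, hL⟩
  obtain ⟨ℓ, rfl⟩ := exists_linForm_eq hf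
  exact h ℓ fun v hv => by rw [← eval_linForm, hL v hv]

theorem linearIdeal_anti {L L' : Submodule K (Fin N → K)} (h : L ≤ L') :
    linearIdeal L' ≤ linearIdeal L :=
  linearIdeal_le fun _ hℓ => linForm_mem_linearIdeal fun v hv => hℓ v (h hv)

theorem irrelevantIdeal_eq : irrelevantIdeal K N = linearIdeal ⊥ := by
  refine le_antisymm (Ideal.span_le.2 ?_) (linearIdeal_le fun ℓ _ => ?_)
  · rintro _ ⟨i, rfl⟩
    rw [← linForm_proj]
    exact linForm_mem_linearIdeal (by simp)
  · rw [linForm_apply]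
    refine Ideal.sum_mem _ fun i _ => ?_
    rw [MvPolynomial.smul_eq_C_mul]
    exact Ideal.mul_mem_left _ _ (Ideal.subset_span (Set.mem_range_self i))

theorem linearIdeal_le_irrelevantIdeal (L : Submodule K (Fin N → K)) :
    linearIdeal L ≤ irrelevantIdeal K N :=
  irrelevantIdeal_eq (K := K) (N := N) ▸ linearIdeal_anti bot_le

theorem mem_irrelevantIdeal_pow {a : ℕ} {f : MvPolynomial (Fin N) K} :
    f ∈ irrelevantIdeal K N ^ a ↔ ∀ x : Fin N →₀ ℕ, x.degree < a → f.coeff x = 0 :=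
  MvPolynomial.mem_pow_idealOfVars_iff' a f

theorem isHomogeneous_mem_irrelevantIdeal_pow {i : ℕ} {f : MvPolynomial (Fin N) K}
    (hf : f.IsHomogeneous i) : f ∈ irrelevantIdeal K N ^ i :=
  mem_irrelevantIdeal_pow.2 fun _ hx => hf.coeff_eq_zero hx.ne

theorem eq_zero_of_mem_irrelevantIdeal_pow {i a : ℕ} {f : MvPolynomial (Fin N) K}
    (hf : f.IsHomogeneous i) (h : f ∈ irrelevantIdeal K N ^ a) (hi : i < a) : f = 0 := by
  ext x
  by_cases hx : x.degree = i
  · simpa using mem_irrelevantIdeal_pow.1 h x (hx ▸ hi)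
  · simpa using hf.coeff_eq_zero hx

theorem eq_zero_of_mem_linearIdeal_pow {i a : ℕ} {f : MvPolynomial (Fin N) K}
    {L : Submodule K (Fin N → K)} (hf : f.IsHomogeneous i) (h : f ∈ linearIdeal L ^ a)
    (hi : i < a) : f = 0 :=
  eq_zero_of_mem_irrelevantIdeal_pow hf (Ideal.pow_right_mono (linearIdeal_le_irrelevantIdeal L) a h) hi

theorem sub_homogeneousComponent_mem {i : ℕ} {f : MvPolynomial (Fin N) K}
    (hf : f ∈ irrelevantIdeal K N ^ i) :
    f - MvPolynomial.homogeneousComponent i f ∈ irrelevantIdeal K N ^ (i + 1) := by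
  refine mem_irrelevantIdeal_pow.2 fun x hx => ?_
  rw [MvPolynomial.coeff_sub, MvPolynomial.coeff_homogeneousComponent]
  split_ifs with h
  · simp
  · simp [mem_irrelevantIdeal_pow.1 hf x (by omega)]

section Graded

attribute [local instance] MvPolynomial.gradedAlgebra

/-- The ideal is generated by linear forms, so its powers are homogeneous. -/
theorem homogeneousComponent_mem_linearIdeal_pow {L : Submodule K (Fin N → K)} {a : ℕ}
    {f : MvPolynomial (Fin N) K} (hf : f ∈ linearIdeal L ^ a) (i : ℕ) :
    MvPolynomial.homogeneousComponent i f ∈ linearIdeal L ^ a := by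
  have h1 : (linearIdeal L).IsHomogeneous (MvPolynomial.homogeneousSubmodule (Fin N) K) :=
    Ideal.homogeneous_span _ _ fun x hx => ⟨1, hx.1⟩
  have h : (linearIdeal L ^ a).IsHomogeneous (MvPolynomial.homogeneousSubmodule (Fin N) K) := by
    induction a with
    | zero => rw [pow_zero, Ideal.one_eq_top]; exact Ideal.IsHomogeneous.top _
    | succ a ih => rw [pow_succ]; exact (ih (Ideal.pow_le_pow_right a.le_succ hf)).mul h1
  exact MvPolynomial.homogeneousComponent_mem_of_mem h hf i

end Graded

/-- The pullback of polynomial functions along a linear map. -/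
noncomputable def pullback (φ : (Fin M → K) →ₗ[K] (Fin N → K)) :
    MvPolynomial (Fin N) K →ₐ[K] MvPolynomial (Fin M) K :=
  MvPolynomial.aeval fun i => linForm (LinearMap.proj i ∘ₗ φ)

theorem linForm_comp (φ : (Fin M → K) →ₗ[K] (Fin N → K)) (ℓ : Module.Dual K (Fin N → K)) :
    linForm (ℓ ∘ₗ φ) = ∑ i, ℓ (Pi.single i 1) • linForm (LinearMap.proj i ∘ₗ φ) := by
  have h : ℓ ∘ₗ φ = ∑ i, ℓ (Pi.single i 1) • (LinearMap.proj i ∘ₗ φ) := by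
    conv_lhs => rw [dual_eq_sum ℓ]
    ext
    simp
  rw [h, map_sum]
  simp_rw [map_smul]

theorem pullback_linForm (φ : (Fin M → K) →ₗ[K] (Fin N → K)) (ℓ : Module.Dual K (Fin N → K)) :
    pullback φ (linForm ℓ) = linForm (ℓ ∘ₗ φ) := by
  rw [linForm_comp, linForm_apply ℓ, map_sum]
  simp_rw [map_smul, pullback, MvPolynomial.aeval_X]

theorem isHomogeneous_pullback (φ : (Fin M → K) →ₗ[K] (Fin N → K)) {i : ℕ}
    {f : MvPolynomial (Fin N) K} (hf : f.IsHomogeneous i) : (pullback φ f).IsHomogeneous i := by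
  have h := hf.aeval (fun j => linForm (LinearMap.proj j ∘ₗ φ)) fun j => isHomogeneous_linForm _
  rwa [one_mul] at h

theorem pullback_mem_linearIdeal_pow (φ : (Fin M → K) →ₗ[K] (Fin N → K))
    {L : Submodule K (Fin N → K)} {a : ℕ} {f : MvPolynomial (Fin N) K}
    (hf : f ∈ linearIdeal L ^ a) : pullback φ f ∈ linearIdeal (L.comap φ) ^ a := by
  have h : linearIdeal L ≤ (linearIdeal (L.comap φ)).comap (pullback φ) :=
    linearIdeal_le fun ℓ hℓ => by
      rw [Ideal.mem_comap, pullback_linForm]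
      exact linForm_mem_linearIdeal fun v hv => hℓ _ hv
  exact Ideal.le_comap_pow _ _ (Ideal.pow_right_mono h a hf)

end LinearForms

/-! ### Splitting off a point and expanding along it -/

section Splitting

variable {K : Type*} [Field K] {M N : ℕ}

/-- A decomposition of `K ^ N` as the direct sum of the line through `v` and the image of the
injective map `ψ`. -/
structure Splitting (v : Fin N → K) (ψ : (Fin M → K) →ₗ[K] (Fin N → K)) where
  /-- The coordinate along `v`. -/
  coord : Module.Dual K (Fin N → K)
  /-- The projection from `v`. -/
  proj : (Fin N → K) →ₗ[K] (Fin M → K)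
  coord_self : coord v = 1
  coord_comp : coord ∘ₗ ψ = 0
  proj_self : proj v = 0
  proj_comp : proj ∘ₗ ψ = LinearMap.id
  decomp : ∀ x, coord x • v + ψ (proj x) = x

/-- A point outside of a hyperplane defines a splitting. -/
theorem exists_splitting {v : Fin (M + 1) → K} {ψ : (Fin M → K) →ₗ[K] (Fin (M + 1) → K)}
    (hψ : Function.Injective ψ) (hv : v ∉ LinearMap.range ψ) : Nonempty (Splitting v ψ) := by
  let θ : (K × (Fin M → K)) →ₗ[K] (Fin (M + 1) → K) := (LinearMap.toSpanSingleton K _ v).coprod ψ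
  have hθ : Function.Injective θ := by
    rw [← LinearMap.ker_eq_bot, LinearMap.ker_eq_bot']
    rintro ⟨t, y⟩ h
    have h' : t • v + ψ y = 0 := by simpa [θ] using h
    have ht : t = 0 := by
      by_contra ht
      refine hv ⟨-(t⁻¹ • y), ?_⟩
      rw [map_neg, map_smul, ← smul_right_injective _ ht |>.eq_iff]
      simp only [smul_neg, smul_smul, mul_inv_cancel₀ ht, one_smul]
      exact (eq_neg_of_add_eq_zero_left h').symm
    subst ht
    have : ψ y = ψ 0 := by simpa using h'
    simp [hψ this]
  let e := LinearEquiv.ofInjectiveOfFinrankEq θ hθ (by simp [add_comm])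
  have he : ∀ z, e z = θ z := fun z => rfl
  have h1 : e.symm v = (1, 0) := by rw [LinearEquiv.symm_apply_eq, he]; simp [θ]
  have h2 : ∀ y, e.symm (ψ y) = (0, y) := fun y => by rw [LinearEquiv.symm_apply_eq, he]; simp [θ]
  exact ⟨{
    coord := LinearMap.fst K K (Fin M → K) ∘ₗ e.symm.toLinearMap
    proj := LinearMap.snd K K (Fin M → K) ∘ₗ e.symm.toLinearMap
    coord_self := by simp [h1]
    coord_comp := by ext; simp [h2]
    proj_self := by simp [h1]
    proj_comp := by ext; simp [h2]
    decomp := fun x => by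
      have h : θ (e.symm x) = x := by rw [← he, LinearEquiv.apply_symm_apply]
      simpa [θ] using h }⟩

/-- The kernel of a nonzero functional on `K ^ (M + 1)` is parametrized by `K ^ M`. -/
theorem exists_injective_range_eq_ker {ξ : Module.Dual K (Fin (M + 1) → K)} {v : Fin (M + 1) → K}
    (hξ : ξ v ≠ 0) : ∃ ψ : (Fin M → K) →ₗ[K] (Fin (M + 1) → K),
      Function.Injective ψ ∧ LinearMap.range ψ = LinearMap.ker ξ := by
  have hr : Module.finrank K (LinearMap.ker ξ) = M := by
    have := LinearMap.finrank_range_add_finrank_ker ξ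
    have h1 : LinearMap.range ξ = ⊤ :=
      LinearMap.range_eq_top.2 (LinearMap.surjective fun h => hξ (by simp [h]))
    rw [h1, finrank_top] at this
    simp at this
    omega
  let e : (Fin M → K) ≃ₗ[K] LinearMap.ker ξ := LinearEquiv.ofFinrankEq _ _ (by simp [hr])
  exact ⟨(LinearMap.ker ξ).subtype ∘ₗ e.toLinearMap,
    (Submodule.injective_subtype _).comp e.injective,
    by rw [LinearMap.range_comp_of_range_eq_top _ e.range, Submodule.range_subtype]⟩

/-- A point outside of a subspace is part of a splitting with complement containing the subspace. -/
theorem exists_splitting_of_notMem {v : Fin (M + 1) → K} {A : Submodule K (Fin (M + 1) → K)}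
    (hv : v ∉ A) : ∃ ψ : (Fin M → K) →ₗ[K] (Fin (M + 1) → K),
      A ≤ LinearMap.range ψ ∧ Nonempty (Splitting v ψ) := by
  obtain ⟨ξ, hξ, hA⟩ := Submodule.exists_le_ker_of_notMem hv
  obtain ⟨ψ, hψ, hran⟩ := exists_injective_range_eq_ker hξ
  exact ⟨ψ, hran.symm ▸ hA, exists_splitting hψ (by rw [hran]; exact hξ)⟩

variable {v : Fin N → K} {ψ : (Fin M → K) →ₗ[K] (Fin N → K)}

variable (v ψ) in
/-- The expansion `f (T v + ψ y)` as a polynomial in `T` with coefficients polynomials in `y`. -/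
noncomputable def expand :
    MvPolynomial (Fin N) K →ₐ[K] Polynomial (MvPolynomial (Fin M) K) :=
  MvPolynomial.aeval fun i => Polynomial.C (linForm (LinearMap.proj i ∘ₗ ψ)) +
    v i • Polynomial.X

theorem expand_linForm (ℓ : Module.Dual K (Fin N → K)) :
    expand v ψ (linForm ℓ) = Polynomial.C (linForm (ℓ ∘ₗ ψ)) + ℓ v • Polynomial.X := by
  have h : ℓ v = ∑ i, ℓ (Pi.single i 1) * v i := by
    conv_lhs => rw [dual_eq_sum ℓ]
    simp
  rw [linForm_comp, linForm_apply ℓ, map_sum, h, map_sum, Finset.sum_smul,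
    ← Finset.sum_add_distrib]
  refine Finset.sum_congr rfl fun i _ => ?_
  rw [map_smul, expand, MvPolynomial.aeval_X, smul_add, Polynomial.smul_C, mul_smul]

/-- Both `T` and the coordinates `y` have weight one; the proof inducts on products of linear forms.
-/
theorem expand_coeff_isHomogeneous {m : ℕ} {f : MvPolynomial (Fin N) K} (hf : f.IsHomogeneous m) :
    ∀ e, (∀ i, e + i = m → ((expand v ψ f).coeff e).IsHomogeneous i) ∧
      (m < e → (expand v ψ f).coeff e = 0) := by
  rw [← MvPolynomial.mem_homogeneousSubmodule, ← MvPolynomial.homogeneousSubmodule_one_pow] at hf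
  induction hf using Submodule.pow_induction_on_left' with
  | algebraMap r =>
    intro e
    rw [AlgHom.commutes, Polynomial.algebraMap_apply, Polynomial.coeff_C]
    refine ⟨fun i hi => ?_, fun h => by simp [h.ne']⟩
    obtain ⟨rfl, rfl⟩ : e = 0 ∧ i = 0 := by omega
    simpa using MvPolynomial.isHomogeneous_C (Fin M) r
  | add f g i _ _ hf hg =>
    intro e
    rw [map_add, Polynomial.coeff_add]
    exact ⟨fun j hj => ((hf e).1 j hj).add ((hg e).1 j hj), fun h => by
      rw [(hf e).2 h, (hg e).2 h, add_zero]⟩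
  | mem_mul l hl i f _ hf =>
    obtain ⟨ℓ, rfl⟩ := exists_linForm_eq hl
    intro e
    rw [map_mul, expand_linForm, add_mul, Polynomial.coeff_add, Polynomial.coeff_C_mul,
      smul_mul_assoc, Polynomial.coeff_smul]
    refine ⟨fun j hj => ?_, fun h => ?_⟩
    · refine MvPolynomial.IsHomogeneous.add ?_ ?_
      · rcases Nat.lt_or_ge i e with h | h
        · rw [(hf e).2 h, mul_zero]; exact MvPolynomial.isHomogeneous_zero _ _ _
        · have := (isHomogeneous_linForm (ℓ ∘ₗ ψ)).mul ((hf e).1 (i - e) (by omega))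
          convert this using 1; omega
      · rw [← MvPolynomial.mem_homogeneousSubmodule]
        refine Submodule.smul_mem _ _ ?_
        cases e with
        | zero => simp
        | succ e => rw [Polynomial.coeff_X_mul]; exact (hf e).1 j (by omega)
    · cases e with
      | zero => omega
      | succ e => rw [Polynomial.coeff_X_mul, (hf e).2 (by omega), (hf (e + 1)).2 (by omega)]; simp

/-- A linear form vanishing on `L` vanishes at `v`, so its expansion has no `T` term and no order is
lost. -/
theorem expand_coeff_mem_of_mem {L : Submodule K (Fin N → K)} (hv : v ∈ L) {a : ℕ}
    {f : MvPolynomial (Fin N) K} (hf : f ∈ linearIdeal L ^ a) (e : ℕ) :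
    (expand v ψ f).coeff e ∈ linearIdeal (L.comap ψ) ^ a := by
  have h : linearIdeal L ≤ ((linearIdeal (L.comap ψ)).map Polynomial.C).comap (expand v ψ) :=
    linearIdeal_le fun ℓ hℓ => by
      rw [Ideal.mem_comap, expand_linForm, hℓ v hv, zero_smul, add_zero]
      exact Ideal.mem_map_of_mem _ (linForm_mem_linearIdeal fun y hy => hℓ _ hy)
  have h2 := Ideal.le_comap_pow _ _ (Ideal.pow_right_mono h a hf)
  rw [Ideal.mem_comap, ← Ideal.map_pow] at h2
  exact Ideal.mem_map_C_iff.1 h2 e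

/-- Without `v ∈ L`, a linear form vanishing on `L` expands to one vanishing on the trace plus a
multiple of `T`: each power of `T` costs at most one order. -/
theorem expand_coeff_mem {L : Submodule K (Fin N → K)} {a : ℕ}
    {f : MvPolynomial (Fin N) K} (hf : f ∈ linearIdeal L ^ a) (e : ℕ) :
    (expand v ψ f).coeff e ∈ linearIdeal (L.comap ψ) ^ (a - e) := by
  let J (a : ℕ) : Ideal (Polynomial (MvPolynomial (Fin M) K)) :=
    { carrier := {g | ∀ e, g.coeff e ∈ linearIdeal (L.comap ψ) ^ (a - e)}
      zero_mem' := fun e => by simp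
      add_mem' := fun hf hg e => by rw [Polynomial.coeff_add]; exact Ideal.add_mem _ (hf e) (hg e)
      smul_mem' := fun c g hg e => by
        rw [smul_eq_mul, Polynomial.coeff_mul]
        refine Ideal.sum_mem _ fun x hx => Ideal.mul_mem_left _ _ ?_
        have := Finset.HasAntidiagonal.mem_antidiagonal.1 hx
        exact Ideal.pow_le_pow_right (by omega) (hg x.2) }
  suffices h : linearIdeal L ^ a ≤ (J a).comap (expand v ψ) from h hf e
  clear hf
  induction a with
  | zero => intro f _ e; simp
  | succ a ih =>
    rw [pow_succ']
    -- Membership in a colon ideal reduces multiplication by the whole ideal to multiplication by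
    -- its generating linear forms.
    have h1 : linearIdeal L ≤ ((J (a + 1)).comap (expand v ψ)).colon
        ((J a).comap (expand v ψ) : Set (MvPolynomial (Fin N) K)) := by
      refine linearIdeal_le fun ℓ hℓ => ?_
      rw [Submodule.mem_colon]
      intro g hg e
      rw [smul_eq_mul, map_mul, expand_linForm, add_mul, Polynomial.coeff_add,
        Polynomial.coeff_C_mul, smul_mul_assoc, Polynomial.coeff_smul]
      refine Ideal.add_mem _ ?_ (Submodule.smul_of_tower_mem (linearIdeal (L.comap ψ) ^ (a + 1 - e)) _ ?_)
      · have := Ideal.mul_mem_mul (linForm_mem_linearIdeal (L := L.comap ψ) (ℓ := ℓ ∘ₗ ψ)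
          fun y hy => hℓ _ hy) (hg e)
        rw [← pow_succ'] at this
        exact Ideal.pow_le_pow_right (by omega) this
      · cases e with
        | zero => simp
        | succ e =>
          rw [Polynomial.coeff_X_mul]
          exact Ideal.pow_le_pow_right (by omega) (hg e)
    refine Ideal.mul_le.2 fun x hx y hy => ?_
    exact Submodule.mem_colon.1 (h1 hx) y (ih hy)

namespace Splitting

variable (s : Splitting v ψ)
include s

theorem proj_apply (y : Fin M → K) : s.proj (ψ y) = y := LinearMap.congr_fun s.proj_comp y

theorem coord_apply (y : Fin M → K) : s.coord (ψ y) = 0 := LinearMap.congr_fun s.coord_comp y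

theorem expand_coord : expand v ψ (linForm s.coord) = Polynomial.X := by
  rw [expand_linForm, s.coord_comp, s.coord_self]; simp

theorem expand_pullback (g : MvPolynomial (Fin M) K) :
    expand v ψ (pullback s.proj g) = Polynomial.C g := by
  have : (expand v ψ).comp (pullback s.proj) = IsScalarTower.toAlgHom K
      (MvPolynomial (Fin M) K) (Polynomial (MvPolynomial (Fin M) K)) := by
    ext i : 1
    rw [AlgHom.comp_apply, ← linForm_proj, pullback_linForm, expand_linForm, LinearMap.comp_assoc,
      s.proj_comp, LinearMap.comp_apply, s.proj_self]
    simp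
  exact DFunLike.congr_fun this g

/-- Substituting `coord x` for `T` and `proj x` for `y` turns `T v + ψ y` back into `x`, so the
expansion loses nothing. -/
theorem eval₂_expand (f : MvPolynomial (Fin N) K) :
    Polynomial.eval₂ (pullback s.proj : MvPolynomial (Fin M) K →+* _) (linForm s.coord)
      (expand v ψ f) = f := by
  induction f using MvPolynomial.induction_on with
  | C a =>
    rw [← MvPolynomial.algebraMap_eq, AlgHom.commutes, Polynomial.algebraMap_apply,
      Polynomial.eval₂_C, RingHom.coe_coe, AlgHom.commutes]
  | add f g hf hg => rw [map_add, Polynomial.eval₂_add, hf, hg]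
  | mul_X f i hf =>
    rw [map_mul, Polynomial.eval₂_mul, hf]
    congr 1
    rw [← linForm_proj i, expand_linForm, Polynomial.eval₂_add, Polynomial.eval₂_C,
      RingHom.coe_coe, pullback_linForm, ← algebraMap_smul (MvPolynomial (Fin M) K),
      Polynomial.eval₂_smul, Polynomial.eval₂_X, RingHom.coe_coe, AlgHom.commutes,
      ← Algebra.smul_def, ← map_smul, ← map_add]
    congr 1
    refine LinearMap.ext fun x => ?_
    conv_rhs => rw [← s.decomp x]
    simp only [LinearMap.add_apply, LinearMap.comp_apply, LinearMap.smul_apply, map_add, map_smul,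
      smul_eq_mul]
    ring

theorem eq_sum (f : MvPolynomial (Fin N) K) :
    f = (expand v ψ f).sum fun e g => pullback s.proj g * linForm s.coord ^ e := by
  conv_lhs => rw [← s.eval₂_expand f]
  rw [Polynomial.eval₂_eq_sum]; rfl

end Splitting
end Splitting

/-! ### Vanishing along joins -/

section Join

variable {K : Type*} [Field K] {M N : ℕ}

namespace Splitting

variable {v : Fin N → K} {ψ : (Fin M → K) →ₗ[K] (Fin N → K)} (s : Splitting v ψ)
include s

theorem map_proj_mem_iff {L : Submodule K (Fin N → K)} (hv : v ∈ L) {x : Fin N → K} :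
    ψ (s.proj x) ∈ L ↔ x ∈ L := by
  conv_rhs => rw [← s.decomp x]
  exact (Submodule.add_mem_iff_right _ (L.smul_mem _ hv)).symm

theorem comap_comap {L : Submodule K (Fin N → K)} (hv : v ∈ L) :
    (L.comap ψ).comap s.proj = L := by
  ext x
  exact s.map_proj_mem_iff hv

theorem comap_sup {A : Submodule K (Fin N → K)} (hA : A ≤ LinearMap.range ψ) :
    (A ⊔ K ∙ v).comap ψ = A.comap ψ := by
  refine le_antisymm (fun y hy => ?_) (Submodule.comap_mono le_sup_left)
  obtain ⟨a, ha, w, hw, h⟩ := Submodule.mem_sup.1 (Submodule.mem_comap.1 hy)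
  obtain ⟨t, rfl⟩ := Submodule.mem_span_singleton.1 hw
  obtain ⟨z, rfl⟩ := hA ha
  have ht : t = 0 := by
    simpa [s.coord_apply, s.coord_self] using congrArg s.coord h
  rw [Submodule.mem_comap, ← h, ht, zero_smul, add_zero]
  exact ha

theorem comap_span : (K ∙ v).comap ψ = ⊥ := by
  have := s.comap_sup (A := ⊥) bot_le
  rw [bot_sup_eq] at this
  rw [this, Submodule.comap_bot, LinearMap.ker_eq_bot]
  exact Function.LeftInverse.injective s.proj_apply

/-- A subspace through `v` is the cone over its trace, so pulling the coefficients back along `proj`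
recovers the order along `L`. -/
theorem mem_linearIdeal_pow_iff {L : Submodule K (Fin N → K)} (hv : v ∈ L) {a : ℕ}
    {f : MvPolynomial (Fin N) K} :
    f ∈ linearIdeal L ^ a ↔ ∀ e, (expand v ψ f).coeff e ∈ linearIdeal (L.comap ψ) ^ a := by
  refine ⟨fun h e => expand_coeff_mem_of_mem hv h e, fun h => ?_⟩
  rw [s.eq_sum f]
  refine Ideal.sum_mem _ fun e _ => Ideal.mul_mem_right _ _ ?_
  rw [← s.comap_comap hv]
  exact pullback_mem_linearIdeal_pow _ (h e)

/-- The coefficient of `T ^ e` has degree `m - e`. Order `b` at `v` kills it when `m - e < b`;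
otherwise `e ≤ m - b`, and the order `a - e` left along `A` is at least `a + b - m`. -/
theorem mem_linearIdeal_sup {A : Submodule K (Fin N → K)} (hA : A ≤ LinearMap.range ψ) {a b m : ℕ}
    {f : MvPolynomial (Fin N) K} (hf : f.IsHomogeneous m) (ha : f ∈ linearIdeal A ^ a)
    (hb : f ∈ linearIdeal (K ∙ v) ^ b) : f ∈ linearIdeal (A ⊔ K ∙ v) ^ (a + b - m) := by
  rw [s.mem_linearIdeal_pow_iff (le_sup_right (a := A) (Submodule.mem_span_singleton_self v)),
    s.comap_sup hA]
  intro e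
  obtain ⟨h1, h2⟩ := expand_coeff_isHomogeneous (v := v) (ψ := ψ) hf e
  by_cases he : m < e
  · simp [h2 he]
  by_cases heb : m - e < b
  · rw [eq_zero_of_mem_linearIdeal_pow (h1 (m - e) (by omega))
      (expand_coeff_mem_of_mem (Submodule.mem_span_singleton_self v) hb e) heb]
    exact Ideal.zero_mem _
  · exact Ideal.pow_le_pow_right (by omega) (expand_coeff_mem ha e)

end Splitting

theorem mem_linearIdeal_sup_span {A : Submodule K (Fin N → K)} {v : Fin N → K} {a b m : ℕ}
    {f : MvPolynomial (Fin N) K} (hf : f.IsHomogeneous m) (ha : f ∈ linearIdeal A ^ a)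
    (hb : f ∈ linearIdeal (K ∙ v) ^ b) : f ∈ linearIdeal (A ⊔ K ∙ v) ^ (a + b - m) := by
  by_cases hv : v ∈ A
  · rw [sup_eq_left.2 ((Submodule.span_singleton_le_iff_mem _ _).2 hv)]
    by_cases hbm : m < b
    · rw [eq_zero_of_mem_linearIdeal_pow hf hb hbm]
      exact Ideal.zero_mem _
    · exact Ideal.pow_le_pow_right (by omega) ha
  · cases N with
    | zero => exact absurd (Subsingleton.elim 0 v ▸ A.zero_mem) hv
    | succ M =>
      obtain ⟨ψ, hA, ⟨s⟩⟩ := exists_splitting_of_notMem hv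
      exact s.mem_linearIdeal_sup hA hf ha hb

/-- A form vanishing to given orders along a subspace and at some points vanishes along their
span. -/
theorem mem_linearIdeal_sup_finset {ι : Type*} (P : ι → ℙ K (Fin N → K))
    {Q : Submodule K (Fin N → K)} {b : ι → ℕ} {c m : ℕ} {f : MvPolynomial (Fin N) K}
    (hf : f.IsHomogeneous m) (hQ : f ∈ linearIdeal Q ^ c)
    (hP : ∀ r, f ∈ linearIdeal (P r).submodule ^ b r) (S : Finset ι) :
    f ∈ linearIdeal (Q ⊔ S.sup fun r => (P r).submodule) ^ (c + ∑ r ∈ S, b r - S.card * m) := by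
  classical
  induction S using Finset.induction_on with
  | empty => simpa using hQ
  | insert r S hr ih =>
    rw [Finset.sup_insert, Finset.sum_insert hr, Finset.card_insert_of_notMem hr, sup_left_comm,
      sup_comm, add_mul, one_mul]
    have h := hP r
    rw [Projectivization.submodule_eq] at h ⊢
    -- Truncating the subtraction after every point can only increase the exponent.
    exact Ideal.pow_le_pow_right (by omega) (mem_linearIdeal_sup_span hf ih h)

end Join

/-! ### Saturation and linear systems -/

section Saturation

variable {K : Type*} [Field K] {M N : ℕ}

theorem le_saturation (I : Ideal (MvPolynomial (Fin N) K)) : I ≤ saturation I :=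
  fun _ hf => ⟨0, fun g _ => I.mul_mem_left g hf⟩

theorem saturation_mono {I J : Ideal (MvPolynomial (Fin N) K)} (h : I ≤ J) :
    saturation I ≤ saturation J :=
  fun _ ⟨t, ht⟩ => ⟨t, fun g hg => h (ht g hg)⟩

theorem saturation_le_of_mul_mem {I J : Ideal (MvPolynomial (Fin N) K)} {t : ℕ}
    (h : ∀ g ∈ irrelevantIdeal K N ^ t, ∀ f ∈ I, g * f ∈ J) : saturation I ≤ saturation J := by
  rintro f ⟨u, hu⟩
  refine ⟨t + u, fun g hg => ?_⟩
  rw [pow_add] at hg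
  refine Submodule.mul_induction_on hg (fun a ha b hb => ?_) fun a b ha hb => ?_
  · rw [mul_assoc]; exact h a ha _ (hu b hb)
  · rw [add_mul]; exact J.add_mem ha hb

theorem saturation_inf_eq {I J : Ideal (MvPolynomial (Fin N) K)} (hI : saturation I = I)
    (hJ : saturation J = J) : saturation (I ⊓ J) = I ⊓ J :=
  le_antisymm (le_inf ((saturation_mono inf_le_left).trans hI.le)
    ((saturation_mono inf_le_right).trans hJ.le)) (le_saturation _)

theorem saturation_iInf_eq {ι : Sort*} {I : ι → Ideal (MvPolynomial (Fin N) K)}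
    (hI : ∀ r, saturation (I r) = I r) : saturation (⨅ r, I r) = ⨅ r, I r :=
  le_antisymm (le_iInf fun r => (saturation_mono (iInf_le _ r)).trans (hI r).le) (le_saturation _)

theorem linForm_mem_irrelevantIdeal (ℓ : Module.Dual K (Fin N → K)) :
    linForm ℓ ∈ irrelevantIdeal K N :=
  irrelevantIdeal_eq (K := K) (N := N) ▸ linForm_mem_linearIdeal (by simp)

/-- For nonzero `v ∈ L`, multiplication by `coord ^ t` only shifts the coefficients of the
expansion, and membership is tested coefficientwise. For `L = ⊥` the saturation would be everything.
-/
theorem saturation_linearIdeal_pow {L : Submodule K (Fin N → K)} (hL : L ≠ ⊥) (a : ℕ) :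
    saturation (linearIdeal L ^ a) = linearIdeal L ^ a := by
  obtain ⟨v, hv, hv0⟩ := Submodule.exists_mem_ne_zero_of_ne_bot hL
  cases N with
  | zero => exact absurd (Subsingleton.elim v 0) hv0
  | succ M =>
    obtain ⟨ψ, -, ⟨s⟩⟩ := exists_splitting_of_notMem (A := ⊥) (by simpa using hv0)
    refine le_antisymm ?_ (le_saturation _)
    rintro f ⟨t, ht⟩
    have := ht _ (Ideal.pow_mem_pow (linForm_mem_irrelevantIdeal s.coord) t)
    rw [s.mem_linearIdeal_pow_iff hv] at this ⊢
    intro e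
    have h := this (e + t)
    rwa [map_mul, map_pow, s.expand_coord, Polynomial.coeff_X_pow_mul] at h

theorem submodule_ne_bot (p : ℙ K (Fin N → K)) : p.submodule ≠ ⊥ := by
  rw [p.submodule_eq]
  simpa using p.rep_nonzero

theorem saturation_fatPointIdeal {ι : Type*} (p : ι → ℙ K (Fin N → K)) (k : ι → ℕ) :
    saturation (fatPointIdeal p k) = fatPointIdeal p k :=
  saturation_iInf_eq fun r => saturation_linearIdeal_pow (submodule_ne_bot (p r)) (k r)

theorem mem_linearSystem {I : Ideal (MvPolynomial (Fin N) K)} (hI : saturation I = I) {m : ℕ}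
    {f : MvPolynomial (Fin N) K} : f ∈ linearSystem I m ↔ f.IsHomogeneous m ∧ f ∈ I := by
  rw [linearSystem, hI]; rfl

theorem mem_fatPointIdeal {ι : Type*} {p : ι → ℙ K (Fin N → K)} {k : ι → ℕ}
    {f : MvPolynomial (Fin N) K} :
    f ∈ fatPointIdeal p k ↔ ∀ r, f ∈ linearIdeal (p r).submodule ^ k r := Ideal.mem_iInf

instance finite_homogeneousSubmodule (m : ℕ) :
    Module.Finite K (MvPolynomial.homogeneousSubmodule (Fin N) K m) :=
  Module.Finite.iff_fg.2 (MvPolynomial.homogeneousSubmodule_fg (Fin N) K m)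

instance finite_linearSystem (I : Ideal (MvPolynomial (Fin N) K)) (m : ℕ) :
    Module.Finite K (linearSystem I m) :=
  Submodule.finiteDimensional_of_le (inf_le_left : linearSystem I m ≤ _)

end Saturation

/-! ### Leading forms at a point -/

section Leading

variable {K : Type*} [Field K] {M N : ℕ} {v : Fin N → K} {ψ : (Fin M → K) →ₗ[K] (Fin N → K)}

variable (v ψ) in
/-- The leading form of degree `i` at the point `v` of an `m`-ic vanishing there to order `i`. -/
noncomputable def leadingForm (m i : ℕ) : MvPolynomial (Fin N) K →ₗ[K] MvPolynomial (Fin M) K :=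
  (Polynomial.lcoeff (MvPolynomial (Fin M) K) (m - i)).restrictScalars K ∘ₗ
    (expand v ψ).toLinearMap

theorem leadingForm_apply (m i : ℕ) (f : MvPolynomial (Fin N) K) :
    leadingForm v ψ m i f = (expand v ψ f).coeff (m - i) := rfl

theorem isHomogeneous_leadingForm {m i : ℕ} {f : MvPolynomial (Fin N) K} (hf : f.IsHomogeneous m)
    (hi : f ∈ linearIdeal (K ∙ v) ^ i) : (leadingForm v ψ m i f).IsHomogeneous i := by
  by_cases h : m < i
  · rw [eq_zero_of_mem_linearIdeal_pow hf hi h, map_zero]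
    exact MvPolynomial.isHomogeneous_zero _ _ _
  · exact (expand_coeff_isHomogeneous hf (m - i)).1 i (by omega)

/-- Coefficients of degree below `i` vanish by the order at `v`; the others, apart from `e = m - i`,
have degree above `i`. -/
theorem expand_coeff_mem_irrelevantIdeal_pow {m i e : ℕ} {f : MvPolynomial (Fin N) K}
    (hf : f.IsHomogeneous m) (hi : f ∈ linearIdeal (K ∙ v) ^ i) (he : e ≠ m - i) :
    (expand v ψ f).coeff e ∈ irrelevantIdeal K M ^ (i + 1) := by
  by_cases h : m < i
  · rw [eq_zero_of_mem_linearIdeal_pow hf hi h, map_zero]; simp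
  obtain ⟨h1, h2⟩ := expand_coeff_isHomogeneous (v := v) (ψ := ψ) hf e
  by_cases h' : m < e
  · rw [h2 h']; simp
  by_cases h'' : m - e < i
  · rw [eq_zero_of_mem_linearIdeal_pow (h1 (m - e) (by omega))
      (expand_coeff_mem_of_mem (Submodule.mem_span_singleton_self v) hi e) h'']
    simp
  · exact Ideal.pow_le_pow_right (by omega)
      (isHomogeneous_mem_irrelevantIdeal_pow (h1 (m - e) (by omega)))

/-- The polynomials whose initial form of degree `i` belongs to `V`. -/
noncomputable def initialIdeal {i : ℕ} (V : Submodule K (MvPolynomial (Fin M) K))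
    (hV : V ≤ MvPolynomial.homogeneousSubmodule (Fin M) K i) : Ideal (MvPolynomial (Fin M) K) where
  carrier := {g | ∃ w ∈ V, g - w ∈ irrelevantIdeal K M ^ (i + 1)}
  zero_mem' := ⟨0, V.zero_mem, by simp⟩
  add_mem' := by
    rintro a b ⟨w, hw, ha⟩ ⟨z, hz, hb⟩
    exact ⟨w + z, V.add_mem hw hz, by rw [add_sub_add_comm]; exact Ideal.add_mem _ ha hb⟩
  smul_mem' := by
    rintro c g ⟨w, hw, hg⟩
    refine ⟨c.coeff 0 • w, V.smul_mem _ hw, ?_⟩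
    -- Only the constant term of `c` affects the initial form of degree `i`; the rest of `c` raises
    -- the order.
    have h : c • g - c.coeff 0 • w = c * (g - w) + (c - MvPolynomial.C (c.coeff 0)) * w := by
      rw [MvPolynomial.smul_eq_C_mul, smul_eq_mul]; ring
    rw [h]
    refine Ideal.add_mem _ (Ideal.mul_mem_left _ _ hg) ?_
    rw [pow_succ']
    refine Ideal.mul_mem_mul ?_ (isHomogeneous_mem_irrelevantIdeal_pow (hV hw))
    rw [← pow_one (irrelevantIdeal K M), mem_irrelevantIdeal_pow]
    intro x hx
    obtain rfl : x = 0 := by rwa [Nat.lt_one_iff, Finsupp.degree_eq_zero_iff] at hx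
    simp

theorem mem_of_mem_initialIdeal {i : ℕ} {V : Submodule K (MvPolynomial (Fin M) K)}
    {hV : V ≤ MvPolynomial.homogeneousSubmodule (Fin M) K i} {u : MvPolynomial (Fin M) K}
    (hu : u.IsHomogeneous i) (h : u ∈ initialIdeal V hV) : u ∈ V := by
  obtain ⟨w, hw, h⟩ := h
  rwa [sub_eq_zero.1 (eq_zero_of_mem_irrelevantIdeal_pow (hu.sub (hV hw)) h i.lt_succ_self)]

namespace Splitting

variable (s : Splitting v ψ)
include s

theorem sub_leadingForm_mem {m i : ℕ} {f : MvPolynomial (Fin N) K} (hf : f.IsHomogeneous m)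
    (hi : f ∈ linearIdeal (K ∙ v) ^ i) :
    f - linForm s.coord ^ (m - i) * pullback s.proj (leadingForm v ψ m i f) ∈
      linearIdeal (K ∙ v) ^ (i + 1) := by
  rw [s.mem_linearIdeal_pow_iff (Submodule.mem_span_singleton_self v), s.comap_span,
    ← irrelevantIdeal_eq]
  intro e
  rw [map_sub, map_mul, map_pow, s.expand_coord, s.expand_pullback, Polynomial.coeff_sub,
    Polynomial.X_pow_mul, Polynomial.coeff_C_mul, Polynomial.coeff_X_pow]
  by_cases he : e = m - i
  · rw [if_pos he, mul_one, leadingForm_apply, he, sub_self]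
    exact Ideal.zero_mem _
  · rw [if_neg he, mul_zero, sub_zero]
    exact expand_coeff_mem_irrelevantIdeal_pow hf hi he

theorem mem_linearIdeal_pow_succ_iff {m i : ℕ} {f : MvPolynomial (Fin N) K}
    (hf : f.IsHomogeneous m) (hi : f ∈ linearIdeal (K ∙ v) ^ i) :
    f ∈ linearIdeal (K ∙ v) ^ (i + 1) ↔ leadingForm v ψ m i f = 0 := by
  refine ⟨fun h => ?_, fun h => ?_⟩
  · exact eq_zero_of_mem_linearIdeal_pow (isHomogeneous_leadingForm hf hi)
      (expand_coeff_mem_of_mem (Submodule.mem_span_singleton_self v) h _) i.lt_succ_self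
  · simpa [h] using s.sub_leadingForm_mem hf hi

theorem pullback_mem {g : MvPolynomial (Fin M) K} {a : ℕ} (hg : g ∈ irrelevantIdeal K M ^ a) :
    pullback s.proj g ∈ linearIdeal (K ∙ v) ^ a := by
  rw [irrelevantIdeal_eq, ← s.comap_span] at hg
  have := pullback_mem_linearIdeal_pow s.proj hg
  rwa [s.comap_comap (Submodule.mem_span_singleton_self v)] at this

/-- Modulo forms vanishing at `v`, every linear form is a multiple of `coord`, so powers of `coord`
suffice to test saturation near `v`. -/
theorem irrelevantIdeal_le : irrelevantIdeal K N ≤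
    Ideal.span {linForm s.coord} ⊔ linearIdeal (K ∙ v) := by
  rw [irrelevantIdeal_eq]
  refine linearIdeal_le fun ℓ _ => ?_
  have h : linForm ℓ = MvPolynomial.C (ℓ v) * linForm s.coord + linForm (ℓ - ℓ v • s.coord) := by
    rw [map_sub, map_smul, MvPolynomial.smul_eq_C_mul]; ring
  rw [h]
  refine Ideal.add_mem _ (Ideal.mem_sup_left (Ideal.mul_mem_left _ _
    (Ideal.mem_span_singleton_self _))) (Ideal.mem_sup_right (linForm_mem_linearIdeal ?_))
  intro w hw
  obtain ⟨t, rfl⟩ := Submodule.mem_span_singleton.1 hw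
  simp [s.coord_self]

end Splitting

end Leading

/-! ### Raising the multiplicity of a point by one -/

section Step

variable {K : Type*} [Field K] {M N : ℕ} {v : Fin N → K} {ψ : (Fin M → K) →ₗ[K] (Fin N → K)}
  {ι : Type*}

variable (v) in
/-- The `m`-ics vanishing to order `i` at `v` and to order `k r` at the points `P r`. -/
noncomputable def pointedSystem (P : ι → ℙ K (Fin N → K)) (k : ι → ℕ) (m i : ℕ) :
    Submodule K (MvPolynomial (Fin N) K) :=
  linearSystem (linearIdeal (K ∙ v) ^ i ⊓ fatPointIdeal P k) m

variable (v ψ) in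
/-- The leading forms at `v` of the `m`-ics vanishing to order `i` at `v` and to order `k r` at the
points `P r`. -/
noncomputable def leadingForms (P : ι → ℙ K (Fin N → K)) (k : ι → ℕ) (m i : ℕ) :
    Submodule K (MvPolynomial (Fin M) K) :=
  (pointedSystem v P k m i).map (leadingForm v ψ m i)

variable {P : ι → ℙ K (Fin N → K)} {k : ι → ℕ} {m i : ℕ}

theorem mem_pointedSystem (hv : v ≠ 0) {f : MvPolynomial (Fin N) K} :
    f ∈ pointedSystem v P k m i ↔ f.IsHomogeneous m ∧ f ∈ linearIdeal (K ∙ v) ^ i ∧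
      f ∈ fatPointIdeal P k :=
  mem_linearSystem (saturation_inf_eq (saturation_linearIdeal_pow (by simpa using hv) i)
    (saturation_fatPointIdeal P k))

namespace Splitting

variable (s : Splitting v ψ)
include s

theorem ne_zero : v ≠ 0 := by
  rintro rfl
  simpa using s.coord_self

theorem leadingForms_le_homogeneousSubmodule :
    leadingForms v ψ P k m i ≤ MvPolynomial.homogeneousSubmodule (Fin M) K i := by
  rintro _ ⟨f, hf, rfl⟩
  obtain ⟨h1, h2, -⟩ := (mem_pointedSystem s.ne_zero).1 hf
  exact isHomogeneous_leadingForm h1 h2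

theorem finrank_pointedSystem :
    Module.finrank K (pointedSystem v P k m i) =
      Module.finrank K (pointedSystem v P k m (i + 1)) +
        Module.finrank K (leadingForms v ψ P k m i) := by
  have hle : pointedSystem v P k m (i + 1) ≤ pointedSystem v P k m i := fun f hf => by
    rw [mem_pointedSystem s.ne_zero] at hf ⊢
    exact ⟨hf.1, Ideal.pow_le_pow_right i.le_succ hf.2.1, hf.2.2⟩
  have hker : LinearMap.ker ((leadingForm v ψ m i).domRestrict (pointedSystem v P k m i)) =
      (pointedSystem v P k m (i + 1)).comap (pointedSystem v P k m i).subtype := by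
    ext ⟨f, hf⟩
    have hf' := (mem_pointedSystem s.ne_zero).1 hf
    rw [LinearMap.mem_ker, Submodule.mem_comap, LinearMap.domRestrict_apply, Submodule.subtype_apply,
      mem_pointedSystem s.ne_zero, ← s.mem_linearIdeal_pow_succ_iff hf'.1 hf'.2.1]
    exact ⟨fun h => ⟨hf'.1, h, hf'.2.2⟩, fun h => h.2.1⟩
  have : Module.Finite K (pointedSystem v P k m i) := finite_linearSystem _ _
  have := LinearMap.finrank_range_add_finrank_ker
    ((leadingForm v ψ m i).domRestrict (pointedSystem v P k m i))
  rw [hker, LinearMap.range_domRestrict, (Submodule.comapSubtypeEquivOfLe hle).finrank_eq] at this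
  rw [← this, add_comm]; rfl

variable {q : ι → ℙ K (Fin M → K)}

/-- The order forced along the line through `v` and `P r` passes to every coefficient of the
expansion, as the line contains `v`. -/
theorem leadingForms_le (hq : ∀ r, (q r).submodule = (K ∙ v ⊔ (P r).submodule).comap ψ) :
    leadingForms v ψ P k m i ≤ linearSystem (fatPointIdeal q fun r => k r + i - m) i := by
  rintro _ ⟨f, hf, rfl⟩
  obtain ⟨h1, h2, h3⟩ := (mem_pointedSystem s.ne_zero).1 hf
  rw [mem_linearSystem (saturation_fatPointIdeal _ _), mem_fatPointIdeal]
  refine ⟨isHomogeneous_leadingForm h1 h2, fun r => ?_⟩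
  have h := mem_linearIdeal_sup_finset P h1 h2 (mem_fatPointIdeal.1 h3) {r}
  rw [Finset.sup_singleton, Finset.sum_singleton, Finset.card_singleton, one_mul, add_comm i] at h
  rw [hq r]
  exact expand_coeff_mem_of_mem
    (le_sup_left (a := K ∙ v) (Submodule.mem_span_singleton_self v)) h _

/-- The join estimate inside the hyperplane, starting from `⊥` with order `i = deg u`, bounds `u`
along spans of traces; cones over these contain the spans with `v`. -/
theorem pullback_mem_expectedObstruction
    (hq : ∀ r, (q r).submodule = (K ∙ v ⊔ (P r).submodule).comap ψ) {u : MvPolynomial (Fin M) K}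
    (hu : u ∈ linearSystem (fatPointIdeal q fun r => k r + i - m) i) :
    pullback s.proj u ∈
      expectedObstruction m (K ∙ v) (i + 1) (fun r => (P r).submodule) k := by
  rw [mem_linearSystem (saturation_fatPointIdeal _ _), mem_fatPointIdeal] at hu
  refine Ideal.mem_sup_left ⟨s.pullback_mem (isHomogeneous_mem_irrelevantIdeal_pow hu.1), ?_⟩
  refine Ideal.mem_iInf.2 fun S => ?_
  have h0 : u ∈ linearIdeal (⊥ : Submodule K (Fin M → K)) ^ i :=
    irrelevantIdeal_eq (K := K) (N := M) ▸ isHomogeneous_mem_irrelevantIdeal_pow hu.1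
  have h := pullback_mem_linearIdeal_pow s.proj (mem_linearIdeal_sup_finset q hu.1 h0 hu.2 S)
  have hle : K ∙ v ⊔ (S.sup fun r => (P r).submodule) ≤
      (⊥ ⊔ S.sup fun r => (q r).submodule).comap s.proj := by
    rw [bot_sup_eq]
    refine sup_le ?_ (Finset.sup_le fun r hr => ?_)
    · rw [Submodule.span_singleton_le_iff_mem, Submodule.mem_comap, s.proj_self]
      exact Submodule.zero_mem _
    · refine le_trans ?_ (Submodule.comap_mono (Finset.le_sup hr))
      rw [hq r, s.comap_comap (le_sup_left (a := K ∙ v) (Submodule.mem_span_singleton_self v))]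
      exact le_sup_right
  refine Ideal.pow_le_pow_right ?_ (Ideal.pow_right_mono (linearIdeal_anti hle) _ h)
  -- The estimate gives `i + ∑ (k r + i - m) - |S| i`, at least `i + ∑ k r - |S| m`. The `-1` in the
  -- expected exponent cancels against the multiplicity `i + 1`.
  have h1 : ∑ r ∈ S, k r + S.card * i ≤ ∑ r ∈ S, (k r + i - m) + S.card * m := by
    rw [← smul_eq_mul, ← smul_eq_mul, ← Finset.sum_const, ← Finset.sum_const,
      ← Finset.sum_add_distrib, ← Finset.sum_add_distrib]
    exact Finset.sum_le_sum fun r _ => by omega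
  omega

theorem baseLocus_le_expectedObstruction :
    baseLocus (linearIdeal (K ∙ v) ^ i ⊓ fatPointIdeal P k) m ⊔ linearIdeal (K ∙ v) ^ (i + 1) ≤
      expectedObstruction m (K ∙ v) (i + 1) (fun r => (P r).submodule) k := by
  refine sup_le_sup_right (Ideal.span_le.2 fun f hf => ?_) _
  obtain ⟨h1, h2, h3⟩ := (mem_pointedSystem s.ne_zero).1 hf
  refine ⟨h2, Ideal.mem_iInf.2 fun S => ?_⟩
  exact Ideal.pow_le_pow_right (by omega)
    (mem_linearIdeal_sup_finset P h1 h2 (mem_fatPointIdeal.1 h3) S)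

/-- Working in an ideal of prescribed initial forms controls arbitrary polynomial combinations of
the `m`-ics, not only the `m`-ics themselves. -/
theorem expand_coeff_mem_initialIdeal {f : MvPolynomial (Fin N) K}
    (hf : f ∈ baseLocus (linearIdeal (K ∙ v) ^ i ⊓ fatPointIdeal P k) m ⊔
      linearIdeal (K ∙ v) ^ (i + 1)) (e : ℕ) :
    (expand v ψ f).coeff e ∈
      initialIdeal (leadingForms v ψ P k m i) s.leadingForms_le_homogeneousSubmodule := by
  set J := initialIdeal (leadingForms v ψ P k m i) s.leadingForms_le_homogeneousSubmodule
  have hJ : ∀ g ∈ irrelevantIdeal K M ^ (i + 1), g ∈ J :=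
    fun g hg => ⟨0, Submodule.zero_mem _, by simpa using hg⟩
  suffices h : baseLocus (linearIdeal (K ∙ v) ^ i ⊓ fatPointIdeal P k) m ⊔
      linearIdeal (K ∙ v) ^ (i + 1) ≤ (J.map Polynomial.C).comap (expand v ψ) from
    Ideal.mem_map_C_iff.1 (h hf) e
  refine sup_le (Ideal.span_le.2 fun f hf => ?_) fun f hf => ?_
  · refine Ideal.mem_map_C_iff.2 fun e => ?_
    obtain ⟨h1, h2, -⟩ := (mem_pointedSystem s.ne_zero).1 hf
    by_cases he : e = m - i
    · exact ⟨_, ⟨f, hf, rfl⟩, by simp [he, leadingForm_apply]⟩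
    · exact hJ _ (expand_coeff_mem_irrelevantIdeal_pow h1 h2 he)
  · refine Ideal.mem_map_C_iff.2 fun e => hJ _ ?_
    have := expand_coeff_mem_of_mem (ψ := ψ) (Submodule.mem_span_singleton_self v) hf e
    rwa [s.comap_span, ← irrelevantIdeal_eq] at this

theorem mul_mem_baseLocus (hq : ∀ r, (q r).submodule = (K ∙ v ⊔ (P r).submodule).comap ψ)
    (h : linearSystem (fatPointIdeal q fun r => k r + i - m) i ≤ leadingForms v ψ P k m i)
    {g f : MvPolynomial (Fin N) K} (hg : g ∈ irrelevantIdeal K N ^ ((m - i) + (i + 1)))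
    (hf : f ∈ expectedObstruction m (K ∙ v) (i + 1) (fun r => (P r).submodule) k) :
    g * f ∈ baseLocus (linearIdeal (K ∙ v) ^ i ⊓ fatPointIdeal P k) m ⊔
      linearIdeal (K ∙ v) ^ (i + 1) := by
  set B := baseLocus (linearIdeal (K ∙ v) ^ i ⊓ fatPointIdeal P k) m ⊔
    linearIdeal (K ∙ v) ^ (i + 1)
  have hQ : ∀ f ∈ linearIdeal (K ∙ v) ^ (i + 1), f ∈ B := fun f hf => Ideal.mem_sup_right hf
  obtain ⟨f, ⟨hf1, hf2⟩, z, hz, rfl⟩ := Submodule.mem_sup.1 hf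
  rw [mul_add]
  refine B.add_mem ?_ (B.mul_mem_left _ (hQ _ hz))
  -- The exponent `(m - i) + (i + 1)` makes `g` a multiple of `coord ^ (m - i)` plus an element of
  -- order `i + 1` at `v`.
  obtain ⟨c, hc, z, hz, rfl⟩ := Submodule.mem_sup.1
    (Ideal.sup_pow_add_le_pow_sup_pow (Ideal.pow_right_mono s.irrelevantIdeal_le _ hg))
  rw [add_mul]
  refine B.add_mem ?_ (B.mul_mem_right _ (hQ _ hz))
  rw [Ideal.span_singleton_pow] at hc
  obtain ⟨c, rfl⟩ := Ideal.mem_span_singleton'.1 hc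
  rw [mul_assoc]
  refine B.mul_mem_left _ ?_
  rw [s.eq_sum f, Polynomial.sum_def, Finset.mul_sum]
  refine B.sum_mem fun e _ => ?_
  rw [← mul_assoc]
  refine B.mul_mem_right _ ?_
  set G := (expand v ψ f).coeff e
  have hG : G ∈ irrelevantIdeal K M ^ i := by
    have := expand_coeff_mem_of_mem (ψ := ψ) (Submodule.mem_span_singleton_self v) hf1 e
    rwa [s.comap_span, ← irrelevantIdeal_eq] at this
  have hu : MvPolynomial.homogeneousComponent i G ∈ leadingForms v ψ P k m i := by
    refine h ((mem_linearSystem (saturation_fatPointIdeal _ _)).2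
      ⟨MvPolynomial.homogeneousComponent_isHomogeneous _ _, mem_fatPointIdeal.2 fun r => ?_⟩)
    refine homogeneousComponent_mem_linearIdeal_pow ?_ i
    -- Singletons suffice: the exponent `i + 1 + k r - (m + 1)` is that of the induced scheme.
    have := Ideal.mem_iInf.1 hf2 {r}
    rw [Finset.sup_singleton, Finset.sum_singleton, Finset.card_singleton] at this
    rw [hq r]
    refine Ideal.pow_le_pow_right ?_ (expand_coeff_mem_of_mem
      (le_sup_left (a := K ∙ v) (Submodule.mem_span_singleton_self v)) this e)
    omega
  rw [← sub_add_cancel G (MvPolynomial.homogeneousComponent i G), map_add, mul_add]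
  refine B.add_mem (B.mul_mem_left _ (hQ _ (s.pullback_mem (sub_homogeneousComponent_mem hG)))) ?_
  obtain ⟨F, hF, hFG⟩ := hu
  rw [← hFG]
  obtain ⟨h1, h2, -⟩ := (mem_pointedSystem s.ne_zero).1 hF
  -- Modulo order `i + 1`, the cone over a leading form times `coord ^ (m - i)` is the `m`-ic `F`
  -- itself.
  rw [← sub_sub_cancel F (linForm s.coord ^ (m - i) * pullback s.proj (leadingForm v ψ m i F))]
  exact B.sub_mem (Ideal.mem_sup_left (Ideal.subset_span hF)) (hQ _ (s.sub_leadingForm_mem h1 h2))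

/-- A point is only linearly obstructed iff the leading forms fill the induced linear system. -/
theorem onlyLinearlyObstructedStep_iff
    (hq : ∀ r, (q r).submodule = (K ∙ v ⊔ (P r).submodule).comap ψ) :
    OnlyLinearlyObstructedStep m (K ∙ v) (i + 1) (fun r => (P r).submodule) k ↔
      leadingForms v ψ P k m i = linearSystem (fatPointIdeal q fun r => k r + i - m) i := by
  refine ⟨fun h => le_antisymm (s.leadingForms_le hq) fun u hu => ?_, fun h => ?_⟩
  · obtain ⟨t, ht⟩ := h.symm.le (le_saturation _ (s.pullback_mem_expectedObstruction hq hu))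
    have := s.expand_coeff_mem_initialIdeal (P := P)
      (ht _ (Ideal.pow_mem_pow (linForm_mem_irrelevantIdeal s.coord) t)) t
    rw [map_mul, map_pow, s.expand_coord, s.expand_pullback, Polynomial.X_pow_mul,
      Polynomial.coeff_C_mul, Polynomial.coeff_X_pow_self, mul_one] at this
    exact mem_of_mem_initialIdeal ((mem_linearSystem (saturation_fatPointIdeal _ _)).1 hu).1 this
  · exact le_antisymm (saturation_mono s.baseLocus_le_expectedObstruction)
      (saturation_le_of_mul_mem fun g hg f hf => s.mul_mem_baseLocus hq h.ge hg hf)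

/-- In large degree, all forms are leading forms. -/
theorem leadingForms_eq [Fintype ι] (hP : ∀ r, v ∉ (P r).submodule) (h : ∑ r, k r + i ≤ m) :
    leadingForms v ψ P k m i = MvPolynomial.homogeneousSubmodule (Fin M) K i := by
  refine le_antisymm s.leadingForms_le_homogeneousSubmodule fun u hu => ?_
  have hex : ∀ r, ∃ ℓ : Module.Dual K (Fin N → K), ℓ v = 1 ∧ ∀ w ∈ (P r).submodule, ℓ w = 0 := by
    intro r
    obtain ⟨ℓ, h1, h2⟩ := Submodule.exists_le_ker_of_notMem (hP r)
    refine ⟨(ℓ v)⁻¹ • ℓ, by simp [h1], fun w hw => ?_⟩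
    simp [LinearMap.mem_ker.1 (h2 hw)]
  choose ℓ hℓv hℓ using hex
  -- Hyperplanes through the `P r` missing `v`, padded by `coord` to degree `m - i`: the expansion
  -- is monic in `T`, so multiplying the cone over `u` by `F` gives leading form `u`.
  set F := (∏ r, linForm (ℓ r) ^ k r) * linForm s.coord ^ (m - i - ∑ r, k r) with hF
  have hFm : F.IsHomogeneous (m - i) := by
    have h1 := MvPolynomial.IsHomogeneous.prod Finset.univ (fun r => linForm (ℓ r) ^ k r)
      (fun r => 1 * k r) fun r _ => (isHomogeneous_linForm (ℓ r)).pow (k r)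
    have h2 := h1.mul ((isHomogeneous_linForm s.coord).pow (m - i - ∑ r, k r))
    convert h2 using 1
    simp only [one_mul]
    omega
  have hmonic : ∀ r, (expand v ψ (linForm (ℓ r))).Monic ∧
      (expand v ψ (linForm (ℓ r))).natDegree = 1 := by
    intro r
    rw [expand_linForm, hℓv, one_smul, add_comm]
    exact ⟨Polynomial.monic_X_add_C _, Polynomial.natDegree_X_add_C _⟩
  have h1 : (expand v ψ F).Monic := by
    rw [hF, map_mul, map_prod, map_pow, s.expand_coord]
    refine Polynomial.Monic.mul (Polynomial.monic_prod_of_monic _ _ fun r _ => ?_)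
      (Polynomial.monic_X_pow _)
    rw [map_pow]; exact (hmonic r).1.pow _
  have h2 : (expand v ψ F).natDegree = m - i := by
    rw [hF, map_mul, map_prod, map_pow, s.expand_coord, Polynomial.Monic.natDegree_mul
      (Polynomial.monic_prod_of_monic _ _ fun r _ => by rw [map_pow]; exact (hmonic r).1.pow _)
      (Polynomial.monic_X_pow _), Polynomial.natDegree_X_pow, Polynomial.natDegree_prod_of_monic]
    · simp_rw [map_pow, (hmonic _).1.natDegree_pow, (hmonic _).2, mul_one]
      omega
    · intro r _; rw [map_pow]; exact (hmonic r).1.pow _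
  refine ⟨F * pullback s.proj u, (mem_pointedSystem s.ne_zero).2 ⟨?_, ?_, ?_⟩, ?_⟩
  · convert hFm.mul (isHomogeneous_pullback s.proj hu) using 1
    omega
  · exact Ideal.mul_mem_left _ _ (s.pullback_mem (isHomogeneous_mem_irrelevantIdeal_pow hu))
  · refine mem_fatPointIdeal.2 fun r => Ideal.mul_mem_right _ _ (Ideal.mul_mem_right _ _ ?_)
    exact Ideal.mem_of_dvd _ (Finset.dvd_prod_of_mem _ (Finset.mem_univ r))
      (Ideal.pow_mem_pow (linForm_mem_linearIdeal (hℓ r)) _)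
  · rw [leadingForm_apply, map_mul, s.expand_pullback, Polynomial.coeff_mul_C, ← h2,
      h1.coeff_natDegree, one_mul]

end Splitting

end Step

/-! ### Dimension counts -/

section Dimension

variable {K : Type*} [Field K]

theorem finrank_homogeneousSubmodule (N i : ℕ) :
    Module.finrank K (MvPolynomial.homogeneousSubmodule (Fin N) K i) = (N + i - 1).choose i := by
  have h : MvPolynomial.homogeneousSubmodule (Fin N) K i =
      MvPolynomial.restrictSupport K {x : Fin N →₀ ℕ | x.degree = i} := by
    rw [MvPolynomial.homogeneousSubmodule_eq_finsupp_supported]; rfl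
  have h2 : Nat.card {x : Fin N →₀ ℕ | x.degree = i} = (N + i - 1).choose i := by
    have : {x : Fin N →₀ ℕ | x.degree = i} = (Finset.univ : Finset (Fin N)).finsuppAntidiag i := by
      ext x; simp [Finset.mem_finsuppAntidiag, Finsupp.degree_eq_sum]
    rw [this, Nat.card_coe_set_eq, Set.ncard_coe_finset, Finset.card_finsuppAntidiag_nat_eq_choose,
      Finset.card_univ, Fintype.card_fin]
  rw [h, Module.finrank_eq_nat_card_basis (MvPolynomial.basisRestrictSupport K _), h2]

/-- The hockey-stick identity. For `n = k = 0` it would fail. -/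
theorem sum_finrank_homogeneousSubmodule {n : ℕ} (hn : 1 ≤ n) (k : ℕ) :
    ∑ i ∈ Finset.range k, Module.finrank K (MvPolynomial.homogeneousSubmodule (Fin n) K i) =
      (n + k - 1).choose n := by
  obtain ⟨n, rfl⟩ := Nat.exists_eq_add_of_le' hn
  cases k with
  | zero => simp
  | succ k =>
    have := Nat.sum_range_add_choose k n
    rw [show n + 1 + (k + 1) - 1 = k + n + 1 by omega, ← this]
    refine Finset.sum_congr rfl fun i _ => ?_
    rw [finrank_homogeneousSubmodule, show n + 1 + i - 1 = i + n by omega,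
      ← Nat.choose_symm_add]

theorem hilbertFunction_add_finrank {N : ℕ} (I : Ideal (MvPolynomial (Fin N) K)) (m : ℕ) :
    hilbertFunction I m + Module.finrank K (linearSystem I m) =
      Module.finrank K (MvPolynomial.homogeneousSubmodule (Fin N) K m) :=
  Nat.sub_add_cancel (Submodule.finrank_mono inf_le_left)

theorem Splitting.finrank_pointedSystem_zero {M N : ℕ} {v : Fin N → K}
    {ψ : (Fin M → K) →ₗ[K] (Fin N → K)} (s : Splitting v ψ) {ι : Type*} (P : ι → ℙ K (Fin N → K))
    (k : ι → ℕ) (m a : ℕ) :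
    Module.finrank K (pointedSystem v P k m 0) = Module.finrank K (pointedSystem v P k m a) +
      ∑ i ∈ Finset.range a, Module.finrank K (leadingForms v ψ P k m i) := by
  induction a with
  | zero => simp
  | succ a ih =>
    rw [ih, s.finrank_pointedSystem, Finset.sum_range_succ]
    ring

variable {M N d : ℕ}

/-- The `m`-ics through the union of the multiple points with index less than `c`. -/
noncomputable def partialSystem (p : Fin d → ℙ K (Fin N → K)) (k : Fin d → ℕ) (m c : ℕ) :
    Submodule K (MvPolynomial (Fin N) K) :=
  linearSystem (fatPointIdeal (fun r : {r : Fin d // r.val < c} => p r) fun r => k r) m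

theorem mem_partialSystem {p : Fin d → ℙ K (Fin N → K)} {k : Fin d → ℕ} {m c : ℕ}
    {f : MvPolynomial (Fin N) K} : f ∈ partialSystem p k m c ↔
      f.IsHomogeneous m ∧ ∀ r : Fin d, r.val < c → f ∈ linearIdeal (p r).submodule ^ k r := by
  rw [partialSystem, mem_linearSystem (saturation_fatPointIdeal _ _), mem_fatPointIdeal,
    Subtype.forall]

theorem partialSystem_zero (p : Fin d → ℙ K (Fin N → K)) (k : Fin d → ℕ) (m : ℕ) :
    partialSystem p k m 0 = MvPolynomial.homogeneousSubmodule (Fin N) K m := by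
  ext f
  rw [mem_partialSystem]
  exact and_iff_left fun r h => absurd h (Nat.not_lt_zero _)

theorem partialSystem_self (p : Fin d → ℙ K (Fin N → K)) (k : Fin d → ℕ) (m : ℕ) :
    partialSystem p k m d = linearSystem (fatPointIdeal p k) m := by
  ext f
  rw [mem_partialSystem, mem_linearSystem (saturation_fatPointIdeal _ _), mem_fatPointIdeal]
  exact and_congr_right fun _ => ⟨fun h r => h r r.2, fun h r _ => h r⟩

theorem pointedSystem_zero (p : Fin d → ℙ K (Fin N → K)) (k : Fin d → ℕ) (m : ℕ) (j : Fin d) :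
    pointedSystem (p j).rep (fun r : {r : Fin d // r < j} => p r) (fun r => k r) m 0 =
      partialSystem p k m j := by
  ext f
  rw [mem_pointedSystem (p j).rep_nonzero, mem_partialSystem, pow_zero, Ideal.one_eq_top,
    mem_fatPointIdeal, Subtype.forall]
  exact and_congr_right fun _ => and_iff_right trivial

theorem pointedSystem_self (p : Fin d → ℙ K (Fin N → K)) (k : Fin d → ℕ) (m : ℕ) (j : Fin d) :
    pointedSystem (p j).rep (fun r : {r : Fin d // r < j} => p r) (fun r => k r) m (k j) =
      partialSystem p k m (j + 1) := by
  ext f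
  rw [mem_pointedSystem (p j).rep_nonzero, mem_partialSystem, mem_fatPointIdeal, Subtype.forall,
    ← Projectivization.submodule_eq]
  refine and_congr_right fun _ => ⟨fun h r hr => ?_, fun h => ⟨h j (Nat.lt_succ_self _),
    fun r hr => h r (Nat.lt_succ_of_lt hr)⟩⟩
  rcases Nat.lt_succ_iff_lt_or_eq.1 hr with hr | hr
  · exact h.2 r hr
  · obtain rfl : r = j := Fin.ext hr
    exact h.1

/-- The Hilbert function of a union of multiple points, built up point by point. -/
theorem hilbertFunction_fatPointIdeal (p : Fin d → ℙ K (Fin N → K)) (k : Fin d → ℕ)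
    {ψ : Fin d → (Fin M → K) →ₗ[K] (Fin N → K)} (s : ∀ j, Splitting (p j).rep (ψ j)) (m : ℕ) :
    hilbertFunction (fatPointIdeal p k) m = ∑ j, ∑ i ∈ Finset.range (k j),
      Module.finrank K (leadingForms (p j).rep (ψ j)
        (fun r : {r : Fin d // r < j} => p r) (fun r : {r : Fin d // r < j} => k r) m i) := by
  -- Telescope the dimensions as points are added, in `ℤ` to avoid truncation.
  have hsum := Finset.sum_range_sub' (fun c => (Module.finrank K (partialSystem p k m c) : ℤ)) d
  rw [← Fin.sum_univ_eq_sum_range fun c => (Module.finrank K (partialSystem p k m c) : ℤ) -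
    Module.finrank K (partialSystem p k m (c + 1)), partialSystem_zero, partialSystem_self,
    ← hilbertFunction_add_finrank (fatPointIdeal p k) m] at hsum
  push_cast at hsum
  rw [add_sub_cancel_right] at hsum
  zify
  rw [← hsum]
  refine Finset.sum_congr rfl fun j _ => ?_
  rw [← pointedSystem_zero, ← pointedSystem_self, (s j).finrank_pointedSystem_zero _ _ m (k j)]
  push_cast
  ring

theorem rep_notMem {p q : ℙ K (Fin N → K)} (h : p ≠ q) : p.rep ∉ q.submodule := by
  intro hp
  refine h (Projectivization.submodule_injective (Submodule.eq_of_le_of_finrank_eq ?_ ?_))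
  · rwa [p.submodule_eq, Submodule.span_singleton_le_iff_mem]
  · rw [p.finrank_submodule, q.finrank_submodule]

theorem hasDegree_fatPointIdeal {n : ℕ} (hn : 1 ≤ n) (k : Fin d → ℕ)
    {p : Fin d → ℙ K (Fin (n + 1) → K)} (hp : Function.Injective p) :
    HasDegree (fatPointIdeal p k) (∑ j, (n + k j - 1).choose n) := by
  have hex : ∀ j, ∃ ψ : (Fin n → K) →ₗ[K] (Fin (n + 1) → K), Nonempty (Splitting (p j).rep ψ) :=
    fun j => by
      obtain ⟨ψ, -, h⟩ := exists_splitting_of_notMem (A := ⊥) (v := (p j).rep)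
        (by simpa using (p j).rep_nonzero)
      exact ⟨ψ, h⟩
  choose ψ s using hex
  -- One sum bounds the earlier multiplicities, the other the order `i < k j`, so all forms occur as
  -- leading forms.
  refine Filter.eventually_atTop.2 ⟨∑ j, k j + ∑ j, k j, fun t ht => ?_⟩
  rw [hilbertFunction_fatPointIdeal p k fun j => (s j).some]
  refine Finset.sum_congr rfl fun j _ => ?_
  rw [← sum_finrank_homogeneousSubmodule (K := K) hn]
  refine Finset.sum_congr rfl fun i hi => ?_
  have h1 : ∑ r : {r : Fin d // r < j}, k r ≤ ∑ r, k r := by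
    rw [← Fintype.sum_subtype_add_sum_subtype (fun r => r < j) k]
    exact Nat.le_add_right _ _
  have h2 : k j ≤ ∑ r, k r := Finset.single_le_sum (fun _ _ => Nat.zero_le _) (Finset.mem_univ j)
  have h3 := Finset.mem_range.1 hi
  rw [(s j).some.leadingForms_eq (fun r => rep_notMem fun h => r.2.ne (hp h).symm) (by omega)]

/-! ### Avoiding hyperplanes, traces and the obstruction criterion -/

theorem exists_isAvoidingHyperplane [Infinite K] {n : ℕ} (p : Fin d → ℙ K (Fin (n + 1) → K)) :
    ∃ ψ, IsAvoidingHyperplane p ψ := by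
  obtain ⟨ξ, hξ⟩ := Module.exists_dual_forall_apply_ne_zero (K := K)
    -- The extra vector makes the functional nonzero even when `d = 0`.
    (fun o : Option (Fin d) => o.elim (Pi.single 0 1 : Fin (n + 1) → K) fun r => (p r).rep) (by
      rintro (_ | r)
      · simp
      · exact (p r).rep_nonzero)
  obtain ⟨ψ, hψ, hran⟩ := exists_injective_range_eq_ker (hξ none)
  refine ⟨ψ, hψ, fun r h => hξ (some r) ?_⟩
  rw [hran, (p r).submodule_eq, Submodule.span_singleton_le_iff_mem] at h
  exact h

theorem Splitting.exists_trace {v : Fin N → K} {ψ : (Fin M → K) →ₗ[K] (Fin N → K)}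
    (s : Splitting v ψ) {p : ℙ K (Fin N → K)} (hp : v ∉ p.submodule) :
    ∃ q : ℙ K (Fin M → K), q.submodule = (K ∙ v ⊔ p.submodule).comap ψ := by
  have h0 : s.proj p.rep ≠ 0 := by
    intro h
    have h1 := s.decomp p.rep
    rw [h, map_zero, add_zero] at h1
    have hc : s.coord p.rep ≠ 0 := fun hc => p.rep_nonzero (by rw [← h1, hc, zero_smul])
    refine hp ?_
    rw [p.submodule_eq]
    exact Submodule.mem_span_singleton.2 ⟨(s.coord p.rep)⁻¹, by
      rw [inv_smul_eq_iff₀ hc, h1]⟩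
  refine ⟨Projectivization.mk K _ h0, ?_⟩
  have hv : v ∈ K ∙ v ⊔ p.submodule :=
    le_sup_left (a := K ∙ v) (Submodule.mem_span_singleton_self v)
  rw [Projectivization.submodule_mk]
  refine le_antisymm ?_ fun y hy => ?_
  · rw [Submodule.span_singleton_le_iff_mem, Submodule.mem_comap, s.map_proj_mem_iff hv,
      p.submodule_eq]
    exact le_sup_right (a := K ∙ v) (Submodule.mem_span_singleton_self _)
  · obtain ⟨a, ha, b, hb, h⟩ := Submodule.mem_sup.1 (Submodule.mem_comap.1 hy)
    rw [p.submodule_eq] at hb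
    obtain ⟨t, rfl⟩ := Submodule.mem_span_singleton.1 ha
    obtain ⟨u, rfl⟩ := Submodule.mem_span_singleton.1 hb
    rw [← s.proj_apply y, ← h]
    exact Submodule.mem_span_singleton.2 ⟨u, by simp [s.proj_self]⟩

theorem exists_areTraces {n : ℕ} (hn : 1 ≤ n)
    {p : Fin d → ℙ K (Fin (n + 1) → K)} (hp : Function.Injective p)
    {ψ : (Fin n → K) →ₗ[K] (Fin (n + 1) → K)} (s : ∀ j, Splitting (p j).rep ψ) :
    ∃ q : Fin d → Fin d → ℙ K (Fin n → K), AreTraces p ψ q := by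
  have : NeZero n := ⟨by omega⟩
  have hex : ∀ j r, ∃ q : ℙ K (Fin n → K), r < j →
      q.submodule = ((p j).submodule ⊔ (p r).submodule).comap ψ := by
    intro j r
    by_cases h : r < j
    · obtain ⟨q, hq⟩ := (s j).exists_trace (p := p r) (rep_notMem fun e => h.ne (hp e).symm)
      exact ⟨q, fun _ => by rw [hq, (p j).submodule_eq]⟩
    -- An arbitrary value for the irrelevant pairs; it exists since `n ≥ 1`.
    · exact ⟨Projectivization.mk K (Pi.single 0 1) (by simp), fun h' => absurd h' h⟩
  choose q hq using hex
  exact ⟨q, hq⟩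

theorem IsAvoidingHyperplane.splitting {n : ℕ} {p : Fin d → ℙ K (Fin (n + 1) → K)}
    {ψ : (Fin n → K) →ₗ[K] (Fin (n + 1) → K)} (h : IsAvoidingHyperplane p ψ) (j : Fin d) :
    Nonempty (Splitting (p j).rep ψ) :=
  exists_splitting h.1 fun hj => h.2 j (by
    rwa [(p j).submodule_eq, Submodule.span_singleton_le_iff_mem])

theorem onlyExpectedLinearObstructions_iff {n : ℕ} {p : Fin d → ℙ K (Fin (n + 1) → K)} {k : Fin d → ℕ}
    {m : ℕ} {ψ : (Fin n → K) →ₗ[K] (Fin (n + 1) → K)} (s : ∀ j, Splitting (p j).rep ψ)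
    {q : Fin d → Fin d → ℙ K (Fin n → K)} (hq : AreTraces p ψ q) :
    OnlyExpectedLinearObstructions m (fun r => (p r).submodule) k ↔
      ∀ j, ∀ i ∈ Finset.range (k j), leadingForms (p j).rep ψ
        (fun r : {r : Fin d // r < j} => p r) (fun r : {r : Fin d // r < j} => k r) m i =
          linearSystem (inducedIdeal m k q j i) i := by
  have hstep := fun j i => (s j).onlyLinearlyObstructedStep_iff (m := m) (i := i)
    (P := fun r : {r : Fin d // r < j} => p r) (k := fun r : {r : Fin d // r < j} => k r)
    (q := fun r : {r : Fin d // r < j} => q j r)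
    fun r => by rw [hq j r r.2, (p j).submodule_eq]
  refine forall_congr' fun j => ⟨fun h i hi => (hstep j i).1 ?_, fun h b hb hbk => ?_⟩
  · rw [← (p j).submodule_eq]
    exact h (i + 1) (by omega) (Finset.mem_range.1 hi)
  · obtain ⟨i, rfl⟩ := Nat.exists_eq_add_of_le' hb
    have := (hstep j i).2 (h i (Finset.mem_range.2 hbk))
    rwa [← (p j).submodule_eq] at this

end Dimension

end FatPoints

/-- The sums may run over every `j`: for the first point the induced ideal is an empty infimum,
hence `⊤`, and contributes zero. -/
theorem theorem1p3 {K : Type*} [Field K] [Infinite K] (n m d : ℕ) (hn : 1 ≤ n)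
    (k : Fin d → ℕ) (p : Fin d → ℙ K (Fin (n + 1) → K)) (hp : Function.Injective p) :
    FatPoints.HasDegree (FatPoints.fatPointIdeal p k) (∑ j, (n + k j - 1).choose n) ∧
    (∃ ψ, FatPoints.IsAvoidingHyperplane p ψ) ∧
    ∀ ψ, FatPoints.IsAvoidingHyperplane p ψ →
      ∃ q : Fin d → Fin d → ℙ K (Fin n → K), FatPoints.AreTraces p ψ q ∧
        (FatPoints.hilbertFunction (FatPoints.fatPointIdeal p k) m : ℤ) ≤
          ((∑ j, (n + k j - 1).choose n : ℕ) : ℤ) -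
            ∑ j, ∑ i ∈ Finset.range (k j),
              (FatPoints.hilbertFunction (FatPoints.inducedIdeal m k q j i) i : ℤ) ∧
        ((FatPoints.hilbertFunction (FatPoints.fatPointIdeal p k) m : ℤ) =
          ((∑ j, (n + k j - 1).choose n : ℕ) : ℤ) -
            ∑ j, ∑ i ∈ Finset.range (k j),
              (FatPoints.hilbertFunction (FatPoints.inducedIdeal m k q j i) i : ℤ) ↔
          FatPoints.OnlyExpectedLinearObstructions m (fun r => (p r).submodule) k) := by
  refine ⟨FatPoints.hasDegree_fatPointIdeal hn k hp, FatPoints.exists_isAvoidingHyperplane p,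
    fun ψ hψ => ?_⟩
  have s := fun j => (hψ.splitting j).some
  obtain ⟨q, hq⟩ := FatPoints.exists_areTraces hn hp s
  refine ⟨q, hq, ?_⟩
  have hle : ∀ j i, FatPoints.leadingForms (p j).rep ψ (fun r : {r : Fin d // r < j} => p r)
      (fun r : {r : Fin d // r < j} => k r) m i ≤
        FatPoints.linearSystem (FatPoints.inducedIdeal m k q j i) i := fun j i =>
    (s j).leadingForms_le fun r => by rw [hq j r r.2, (p j).submodule_eq]
  -- Expand each point's degree by degrees of forms; subtracting the induced Hilbert functions
  -- leaves the induced systems.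
  have hrhs : ((∑ j, (n + k j - 1).choose n : ℕ) : ℤ) - ∑ j, ∑ i ∈ Finset.range (k j),
      (FatPoints.hilbertFunction (FatPoints.inducedIdeal m k q j i) i : ℤ) =
        ((∑ j, ∑ i ∈ Finset.range (k j), Module.finrank K
          (FatPoints.linearSystem (FatPoints.inducedIdeal m k q j i) i) : ℕ) : ℤ) := by
    rw [sub_eq_iff_eq_add]
    norm_cast
    rw [← Finset.sum_add_distrib]
    refine Finset.sum_congr rfl fun j _ => ?_
    rw [← FatPoints.sum_finrank_homogeneousSubmodule (K := K) hn, ← Finset.sum_add_distrib]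
    refine Finset.sum_congr rfl fun i _ => ?_
    rw [add_comm, FatPoints.hilbertFunction_add_finrank]
  have hfin : ∀ j, ∀ i ∈ Finset.range (k j), Module.finrank K
      (FatPoints.leadingForms (p j).rep ψ (fun r : {r : Fin d // r < j} => p r)
        (fun r : {r : Fin d // r < j} => k r) m i) ≤ Module.finrank K
      (FatPoints.linearSystem (FatPoints.inducedIdeal m k q j i) i) :=
    fun j i _ => Submodule.finrank_mono (hle j i)
  rw [hrhs, FatPoints.hilbertFunction_fatPointIdeal p k s, FatPoints.onlyExpectedLinearObstructions_iff s hq,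
    Nat.cast_le, Nat.cast_inj]
  refine ⟨Finset.sum_le_sum fun j _ => Finset.sum_le_sum (hfin j), ?_⟩
  rw [Finset.sum_eq_sum_iff_of_le fun j _ => Finset.sum_le_sum (hfin j)]
  refine ⟨fun h j i hi => Submodule.eq_of_le_of_finrank_eq (hle j i) ?_, fun h j _ =>
    Finset.sum_congr rfl fun i hi => by rw [h j i hi]⟩
  exact (Finset.sum_eq_sum_iff_of_le (hfin j)).1 (h j (Finset.mem_univ j)) i hi
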